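/- Let $\Psi_0,r_0>0$, let $r=\sqrt{x^2+y^2}$ in $\mathbb{R}^3$, and put $\delta x(\zeta)=-\cos\zeta\,(1-\tfrac13\cos^2\zeta)$, $\delta y(\zeta)=-\tfrac13\sin^3\zeta$. For $\epsilon>0$ let $N'_\epsilon=\{\boldsymbol{x}\in\mathbb{R}^3: r>\epsilon(1+\sqrt2)\}$; at each $\boldsymbol{x}=(x,y,z)\in N'_\epsilon$ let $\zeta\in[0,2\pi)$ be the unique angle such that $x=\rho\cos\zeta+\epsilon\,\delta x(\zeta)$, $y=\rho\sin\zeta+\epsilon\,\delta y(\zeta)$ for some $\rho>\epsilon\sin^2\zeta$, so that $\rho=\sqrt{(x-\epsilon\,\delta x(\zeta))^2+(y-\epsilon\,\delta y(\zeta))^2}$. Define $$\Psi_\epsilon=\Psi_0-(\rho-r_0)^2-z^2\ \text{ on } N'_\epsilon,\qquad \Psi_A=\Psi_0-(r-r_0)^2-z^2\ \text{ on } \mathbb{R}^3 .$$ Let $\epsilon_0>0$ and let $\Omega\subset N'_{\epsilon_0}$ be a bounded set (for instance a bounded region). Then there is $\epsilon_1>0$ such that for every $\epsilon\in(0,\epsilon_1)$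 there is a $C^\infty$ diffeomorphism $\Phi:U\to V$ between open sets $U,V\subset N'_\epsilon$, both containing $\overline{\Omega}$, with $$\Psi_\epsilon(\Phi(\boldsymbol{x}))=\Psi_A(\boldsymbol{x})\qquad\text{for all }\boldsymbol{x}\in U .$$ In particular, the level sets of $\Psi_A$ and $\Psi_\epsilon$ in $\Omega$ are diffeomorphic in the following sense. For every $c\in\mathbb{R}$, $\Phi$ restricts to a diffeomorphism of $\{\Psi_A=c\}\cap\Omega$ onto $\{\Psi_\epsilon=c\}\cap\Phi(\Omega)$, and $\Phi^{-1}$ restricts to a diffeomorphism of $\{\Psi_\epsilon=c\}\cap\Omega$ onto $\{\Psi_A=c\}\cap\Phi^{-1}(\Omega)$. Moreover, if the complete level set $\{\Psi_A=c\}$ or the complete level set $\{\Psi_\epsilon=c\}\subset N'_\epsilon$ is contained in $\Omega$, then $\Phi$ restricts to a diffeomorphism of $\{\Psi_A=c\}$ onto $\{\Psi_\epsilon=c\}$, and if in addition $c<\Psi_0$, both level sets are diffeomorphic to the torus $\mathbb{T}^2=S^1\times S^1$. -/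

import Mathlib

open Set

open scoped ContDiff

/-- Euclidean three-space; the Cartesian coordinates of `X` are `X 0`, `X 1`, `X 2`. -/
abbrev E3 : Type := EuclideanSpace ℝ (Fin 3)

/-- The cylindrical radius `r = √(x² + y²)`. -/
noncomputable def cylRadius (X : E3) : ℝ := Real.sqrt (X 0 ^ 2 + X 1 ^ 2)

/-- The axisymmetric function `Ψ_A = Ψ₀ - (r - r₀)² - z²`. -/
noncomputable def PsiAxi (Ψ₀ r₀ : ℝ) (X : E3) : ℝ :=
  Ψ₀ - (cylRadius X - r₀) ^ 2 - X 2 ^ 2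

/-- The perturbation `δx(ζ) = -cos ζ (1 - cos² ζ / 3)`. -/
noncomputable def deltaX (ζ : ℝ) : ℝ := -(Real.cos ζ * (1 - Real.cos ζ ^ 2 / 3))

/-- The perturbation `δy(ζ) = -sin³ ζ / 3`. -/
noncomputable def deltaY (ζ : ℝ) : ℝ := -(Real.sin ζ ^ 3 / 3)

/-- The open set `N' = {r > ε (1 + √2)}`. -/
def NPrime (ε : ℝ) : Set E3 := {X | ε * (1 + Real.sqrt 2) < cylRadius X}

/-- `ζ` is a perturbed toroidal angle of `X`: for some `ρ > ε sin² ζ` (nonvanishing Jacobian),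
`x = ρ cos ζ + ε δx(ζ)` and `y = ρ sin ζ + ε δy(ζ)`. -/
def IsToroidalAngle (ε : ℝ) (X : E3) (ζ : ℝ) : Prop :=
  ζ ∈ Ico 0 (2 * Real.pi) ∧ ∃ ρ : ℝ, ε * Real.sin ζ ^ 2 < ρ ∧
    X 0 = ρ * Real.cos ζ + ε * deltaX ζ ∧ X 1 = ρ * Real.sin ζ + ε * deltaY ζ

lemma delta_sq_le (ζ : ℝ) : deltaX ζ ^ 2 + deltaY ζ ^ 2 ≤ (2 / 3) ^ 2 := by
  have hs : Real.sin ζ ^ 2 = 1 - Real.cos ζ ^ 2 := by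
    have := Real.sin_sq_add_cos_sq ζ; linarith
  have e : deltaX ζ ^ 2 + deltaY ζ ^ 2
      = Real.cos ζ ^ 2 * (1 - Real.cos ζ ^ 2 / 3) ^ 2 + (Real.sin ζ ^ 2) ^ 3 / 9 := by
    unfold deltaX deltaY; ring
  rw [e, hs]
  nlinarith [sq_nonneg (Real.cos ζ ^ 2 - 1)]

set_option maxHeartbeats 2000000 in
/-- On `N'` the perturbed toroidal angle exists and is unique. -/
theorem existsUnique_isToroidalAngle {ε : ℝ} (hε : 0 < ε) {X : E3} (hX : X ∈ NPrime ε) :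
    ∃! ζ, IsToroidalAngle ε X ζ := by
  have h2 : (1.4 : ℝ) ≤ Real.sqrt 2 := Real.le_sqrt_of_sq_le (by norm_num)
  have hr : 2.4 * ε < cylRadius X := by
    have : ε * (1 + Real.sqrt 2) < cylRadius X := hX
    nlinarith
  set r := cylRadius X with hrdef
  have hrsq : r ^ 2 = X 0 ^ 2 + X 1 ^ 2 := Real.sq_sqrt (by positivity)
  have hr0 : 0 < r := by linarith
  -- any representation with nonnegative radius has radius larger than `ε`
  have big : ∀ ζ ρ : ℝ, 0 ≤ ρ → X 0 = ρ * Real.cos ζ + ε * deltaX ζ →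
      X 1 = ρ * Real.sin ζ + ε * deltaY ζ → ε < ρ := by
    intro ζ ρ hρ h0 h1
    by_contra! hle
    have hd := delta_sq_le ζ
    have hcs := Real.sin_sq_add_cos_sq ζ
    have hdot : (Real.cos ζ * deltaX ζ + Real.sin ζ * deltaY ζ) ≤ 1 := by
      nlinarith [sq_nonneg (Real.cos ζ - deltaX ζ), sq_nonneg (Real.sin ζ - deltaY ζ)]
    have e : r ^ 2 = ρ ^ 2 + 2 * (ρ * ε) * (Real.cos ζ * deltaX ζ + Real.sin ζ * deltaY ζ)
        + ε ^ 2 * (deltaX ζ ^ 2 + deltaY ζ ^ 2) := by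
      rw [hrsq, h0, h1]
      linear_combination ρ ^ 2 * hcs
    have a1 : ρ ^ 2 ≤ ε ^ 2 := by nlinarith
    have a2 : ρ * ε ≤ ε ^ 2 := by nlinarith
    have a3 : (ρ * ε) * (Real.cos ζ * deltaX ζ + Real.sin ζ * deltaY ζ) ≤ (ρ * ε) * 1 :=
      mul_le_mul_of_nonneg_left hdot (by positivity)
    have a4 : ε ^ 2 * (deltaX ζ ^ 2 + deltaY ζ ^ 2) ≤ ε ^ 2 * (2 / 3) ^ 2 :=
      mul_le_mul_of_nonneg_left hd (by positivity)
    nlinarith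
  -- existence, up to multiples of `2π`
  have ex : ∃ ζ ρ : ℝ, 0 ≤ ρ ∧ X 0 = ρ * Real.cos ζ + ε * deltaX ζ ∧
      X 1 = ρ * Real.sin ζ + ε * deltaY ζ := by
    obtain ⟨φ, hc, hs⟩ : ∃ φ : ℝ, X 0 = r * Real.cos φ ∧ X 1 = r * Real.sin φ := by
      have hn : ‖(⟨X 0, X 1⟩ : ℂ)‖ = r := by
        rw [Complex.norm_def, Complex.normSq_mk, hrdef, cylRadius]; ring_nf
      refine ⟨Complex.arg ⟨X 0, X 1⟩, ?_, ?_⟩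
      · rw [← hn, Complex.norm_mul_cos_arg]
      · rw [← hn, Complex.norm_mul_sin_arg]
    let F : ℝ → ℝ := fun s => r * Real.sin s
      - ε * (deltaX (φ + s) * Real.sin (φ + s) - deltaY (φ + s) * Real.cos (φ + s))
    have hFc : ContinuousOn F (Icc (-(Real.pi / 2)) (Real.pi / 2)) := by
      apply Continuous.continuousOn
      simp only [F, deltaX, deltaY]
      fun_prop
    have bd : ∀ t : ℝ, |deltaX t * Real.sin t - deltaY t * Real.cos t| ≤ 1 := by
      intro t
      have hd := delta_sq_le t
      have hcs := Real.sin_sq_add_cos_sq t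
      rw [abs_le]
      constructor
      · nlinarith [sq_nonneg (deltaX t + Real.sin t), sq_nonneg (deltaY t - Real.cos t)]
      · nlinarith [sq_nonneg (deltaX t - Real.sin t), sq_nonneg (deltaY t + Real.cos t)]
    have hF0 : F (-(Real.pi / 2)) ≤ 0 := by
      have := abs_le.1 (bd (φ + -(Real.pi / 2)))
      simp only [F, Real.sin_neg, Real.sin_pi_div_two]
      nlinarith
    have hF1 : 0 ≤ F (Real.pi / 2) := by
      have := abs_le.1 (bd (φ + Real.pi / 2))
      simp only [F, Real.sin_pi_div_two]
      nlinarith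
    obtain ⟨s, hsI, hFs⟩ := intermediate_value_Icc (by linarith [Real.pi_pos]) hFc ⟨hF0, hF1⟩
    have hcos : 0 ≤ Real.cos s := Real.cos_nonneg_of_mem_Icc hsI
    have hcs := Real.sin_sq_add_cos_sq (φ + s)
    have hφ : φ = (φ + s) - s := by ring
    set ζ := φ + s with hζ
    have hc' : X 0 = r * (Real.cos ζ * Real.cos s + Real.sin ζ * Real.sin s) := by
      rw [hc]; conv_lhs => rw [hφ, Real.cos_sub]
    have hs' : X 1 = r * (Real.sin ζ * Real.cos s - Real.cos ζ * Real.sin s) := by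
      rw [hs]; conv_lhs => rw [hφ, Real.sin_sub]
    have hF' : r * Real.sin s
        - ε * (deltaX ζ * Real.sin ζ - deltaY ζ * Real.cos ζ) = 0 := hFs
    refine ⟨ζ, r * Real.cos s - ε * (deltaX ζ * Real.cos ζ + deltaY ζ * Real.sin ζ), ?_, ?_, ?_⟩
    · have : deltaX ζ * Real.cos ζ + deltaY ζ * Real.sin ζ ≤ 0 := by
        have e : deltaX ζ * Real.cos ζ + deltaY ζ * Real.sin ζ
            = -(Real.cos ζ ^ 2 * (1 - Real.cos ζ ^ 2 / 3)) - (Real.sin ζ ^ 2) ^ 2 / 3 := by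
          unfold deltaX deltaY; ring
        have h1 : 0 ≤ 1 - Real.cos ζ ^ 2 / 3 := by linarith [Real.cos_sq_le_one ζ]
        rw [e]
        have := mul_nonneg (sq_nonneg (Real.cos ζ)) h1
        have h5 := sq_nonneg (Real.sin ζ ^ 2)
        linarith
      have h3 := mul_nonneg hr0.le hcos
      have h4 := mul_nonpos_of_nonneg_of_nonpos hε.le this
      linarith
    · rw [hc']
      linear_combination Real.sin ζ * hF' + ε * deltaX ζ * hcs
    · rw [hs']
      linear_combination -Real.cos ζ * hF' + ε * deltaY ζ * hcs
  obtain ⟨ζ, ρ, hρ, h0, h1⟩ := ex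
  have hper : ∀ t : ℝ, ∃ t' ∈ Ico 0 (2 * Real.pi),
      Real.cos t' = Real.cos t ∧ Real.sin t' = Real.sin t := by
    intro t
    refine ⟨toIcoMod Real.two_pi_pos 0 t, by simpa using toIcoMod_mem_Ico Real.two_pi_pos 0 t, ?_⟩
    rw [toIcoMod, zsmul_eq_mul]
    exact ⟨Real.cos_sub_int_mul_two_pi t _, Real.sin_sub_int_mul_two_pi t _⟩
  obtain ⟨ζ', hζ'm, hcζ, hsζ⟩ := hper ζ
  have hbig := big ζ ρ hρ h0 h1
  refine ⟨ζ', ⟨hζ'm, ρ, ?_, ?_, ?_⟩, ?_⟩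
  · nlinarith [Real.sin_sq_le_one ζ']
  · rw [hcζ, h0]; simp only [deltaX, hcζ]
  · rw [hsζ, h1]; simp only [deltaY, hsζ]
  · rintro η ⟨hηm, σ, hσ, k0, k1⟩
    have hσ0 : 0 ≤ σ := by nlinarith [mul_nonneg hε.le (sq_nonneg (Real.sin η))]
    have hσb := big η σ hσ0 k0 k1
    rw [h0] at k0
    rw [h1] at k1
    rw [deltaX, deltaX] at k0
    rw [deltaY, deltaY] at k1
    rw [← hcζ] at k0
    rw [← hsζ] at k1
    have c1 := Real.sin_sq_add_cos_sq ζ'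
    have c2 := Real.sin_sq_add_cos_sq η
    have key : (Real.cos ζ' - Real.cos η) ^ 2 + (Real.sin ζ' - Real.sin η) ^ 2 = 0 := by
      generalize Real.cos ζ' = a at *
      generalize Real.sin ζ' = b at *
      generalize Real.cos η = c at *
      generalize Real.sin η = d at *
      have id1 : (ρ + σ) / 2 * ((a - c) ^ 2 + (b - d) ^ 2)
          = ε * ((a - c) ^ 2 * (1 - (a ^ 2 + a * c + c ^ 2) / 3)
            + (b - d) ^ 2 * ((b ^ 2 + b * d + d ^ 2) / 3)) := by
        linear_combination (a - c) * k0 + (b - d) * k1 + (ρ - σ) / 2 * c2 - (ρ - σ) / 2 * c1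
      have q1 : 0 ≤ a ^ 2 + a * c + c ^ 2 := by nlinarith [sq_nonneg (a + c)]
      have q2 : b ^ 2 + b * d + d ^ 2 ≤ 3 := by
        nlinarith [sq_nonneg (b - d), sq_nonneg a, sq_nonneg c]
      have m1 : (a - c) ^ 2 * (1 - (a ^ 2 + a * c + c ^ 2) / 3) ≤ (a - c) ^ 2 * 1 :=
        mul_le_mul_of_nonneg_left (by linarith) (sq_nonneg _)
      have m2 : (b - d) ^ 2 * ((b ^ 2 + b * d + d ^ 2) / 3) ≤ (b - d) ^ 2 * 1 :=
        mul_le_mul_of_nonneg_left (by linarith) (sq_nonneg _)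
      have m3 := mul_le_mul_of_nonneg_left (add_le_add m1 m2) hε.le
      have q0 : 0 ≤ (a - c) ^ 2 + (b - d) ^ 2 := add_nonneg (sq_nonneg _) (sq_nonneg _)
      rcases q0.eq_or_lt with hq | hq
      · exact hq.symm
      · have hlt : ε * ((a - c) ^ 2 + (b - d) ^ 2) < (ρ + σ) / 2 * ((a - c) ^ 2 + (b - d) ^ 2) :=
          mul_lt_mul_of_pos_right (by linarith) hq
        linarith
    have e1 : Real.cos η = Real.cos ζ' := by
      have h := pow_eq_zero_iff (two_ne_zero) |>.1 (le_antisymm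
        (by linarith [sq_nonneg (Real.sin ζ' - Real.sin η)]) (sq_nonneg (Real.cos ζ' - Real.cos η)))
      linarith
    have e2 : Real.sin η = Real.sin ζ' := by
      have h := pow_eq_zero_iff (two_ne_zero) |>.1 (le_antisymm
        (by linarith [sq_nonneg (Real.cos ζ' - Real.cos η)]) (sq_nonneg (Real.sin ζ' - Real.sin η)))
      linarith
    have hang : (η : Real.Angle) = (ζ' : Real.Angle) := Real.Angle.cos_sin_inj e1 e2
    obtain ⟨k, hk⟩ := Real.Angle.angle_eq_iff_two_pi_dvd_sub.1 hang
    have hpi := Real.pi_pos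
    have hk1 : (k : ℝ) < 1 := by nlinarith [hηm.1, hηm.2, hζ'm.1, hζ'm.2]
    have hk2 : (-1 : ℝ) < k := by nlinarith [hηm.1, hηm.2, hζ'm.1, hζ'm.2]
    have hk0 : k = 0 := by
      have h1 : k < 1 := by exact_mod_cast hk1
      have h2 : -1 < k := by exact_mod_cast hk2
      omega
    rw [hk0] at hk
    simp at hk
    linarith

open Classical in
/-- The perturbed toroidal angle `ζ(x, y)` (only meaningful on `N'`, where it is unique). -/
noncomputable def toroidalAngle (ε : ℝ) (X : E3) : ℝ :=
  if h : ∃ ζ, IsToroidalAngle ε X ζ then h.choose else 0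

/-- The perturbed polar radius `ρ = √((x - ε δx(ζ))² + (y - ε δy(ζ))²)`. -/
noncomputable def rhoPert (ε : ℝ) (X : E3) : ℝ :=
  Real.sqrt ((X 0 - ε * deltaX (toroidalAngle ε X)) ^ 2
    + (X 1 - ε * deltaY (toroidalAngle ε X)) ^ 2)

/-- The perturbed function `Ψ = Ψ₀ - (ρ - r₀)² - z²`. -/
noncomputable def PsiPert (Ψ₀ r₀ ε : ℝ) (X : E3) : ℝ :=
  Ψ₀ - (rhoPert ε X - r₀) ^ 2 - X 2 ^ 2

/-- The level set `{Ψ_A = c}` in three-space. -/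
def levelAxi (Ψ₀ r₀ c : ℝ) : Set E3 := {X | PsiAxi Ψ₀ r₀ X = c}

/-- The level set `{Ψ = c}` in `N'`, where `Ψ` is defined. -/
def levelPert (Ψ₀ r₀ ε c : ℝ) : Set E3 := {X | X ∈ NPrime ε ∧ PsiPert Ψ₀ r₀ ε X = c}

section Diffeo

variable {E F : Type*} [NormedAddCommGroup E] [NormedSpace ℝ E]
  [NormedAddCommGroup F] [NormedSpace ℝ F]

/-- A map on a subset `S` of a normed space is smooth if it locally extends to smooth maps
on open sets. -/
def SmoothOnSubset (f : E → F) (S : Set E) : Prop :=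
  ∀ x ∈ S, ∃ U : Set E, IsOpen U ∧ x ∈ U ∧ ∃ g : E → F, ContDiffOn ℝ ∞ g U ∧ EqOn f g (S ∩ U)

/-- `f` restricts to a diffeomorphism of the subset `S` onto the subset `T`. -/
def IsDiffeoOn (f : E → F) (S : Set E) (T : Set F) : Prop :=
  BijOn f S T ∧ SmoothOnSubset f S ∧
    ∃ g : F → E, LeftInvOn g f S ∧ SmoothOnSubset g T

/-- Two subsets of normed spaces are diffeomorphic. -/
def AreDiffeomorphic (S : Set E) (T : Set F) : Prop := ∃ f : E → F, IsDiffeoOn f S T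

end Diffeo

/-- The two-torus `𝕋² = S¹ × S¹` in `ℝ² × ℝ²`. -/
def torus2 : Set (EuclideanSpace ℝ (Fin 2) × EuclideanSpace ℝ (Fin 2)) :=
  Metric.sphere 0 1 ×ˢ Metric.sphere 0 1

/-! ### Diffeomorphisms between subsets, and perturbations of the identity. -/

section Diffeo

variable {E F G : Type*} [NormedAddCommGroup E] [NormedSpace ℝ E]
  [NormedAddCommGroup F] [NormedSpace ℝ F] [NormedAddCommGroup G] [NormedSpace ℝ G]

/-! The diffeomorphism is explicit: `toroidalShift` moves the point with polar coordinates `(r, ζ)`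
by `ε (δx(ζ), δy(ζ), 0)`. The image has perturbed coordinates `(ρ, ζ)` with `ρ = r`, by uniqueness
of the toroidal angle, so `Ψ_ε` pulls back exactly to `Ψ_A` (`PsiPert_toroidalShift`).

The displacement is `ε` times a map of the unit vector `(cos ζ, sin ζ)` that is 1-Lipschitz, and the
unit vector is `1/(2ε)`-Lipschitz on `r ≥ 2ε`. So the shift differs there from the identity by a
`1/2`-Lipschitz map (`lipschitzOnWith_toroidalShift_sub_id`), and the inverse function theorem makes
it a diffeomorphism onto an open set. Points move by at most `ε`, which keeps the closure of `Ω` in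
source and target for small `ε`.

For complete level sets, `exists_toroidalShift_eq` gives surjectivity, and
`lt_cylRadius_of_levelPert_subset` excludes a piece of `{Ψ_A = c}` near the axis that the perturbed
level set would not see. -/

lemma ContDiffOn.smoothOnSubset {f : E → F} {U S : Set E} (hf : ContDiffOn ℝ ∞ f U)
    (hU : IsOpen U) (hS : S ⊆ U) : SmoothOnSubset f S :=
  fun _ hx => ⟨U, hU, hS hx, f, hf, fun _ _ => rfl⟩

lemma SmoothOnSubset.comp {g : F → G} {f : E → F} {S : Set E} {T : Set F}
    (hg : SmoothOnSubset g T) (hf : SmoothOnSubset f S) (hST : MapsTo f S T) :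
    SmoothOnSubset (g ∘ f) S := by
  intro x hx
  obtain ⟨U, hU, hxU, f', hf', hff'⟩ := hf x hx
  obtain ⟨V, hV, hxV, g', hg', hgg'⟩ := hg (f x) (hST hx)
  refine ⟨U ∩ f' ⁻¹' V, hf'.continuousOn.isOpen_inter_preimage hU hV, ⟨hxU, ?_⟩, g' ∘ f',
    hg'.comp (hf'.mono inter_subset_left) (fun y hy => hy.2), ?_⟩
  · rw [mem_preimage, ← hff' ⟨hx, hxU⟩]
    exact hxV
  · rintro y ⟨hyS, hyU, hyV⟩
    have h := hff' ⟨hyS, hyU⟩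
    rw [mem_preimage, ← h] at hyV
    simp only [Function.comp_apply, ← h]
    exact hgg' ⟨hST hyS, hyV⟩

lemma IsDiffeoOn.exists_symm {f : E → F} {S : Set E} {T : Set F} (h : IsDiffeoOn f S T) :
    ∃ g : F → E, IsDiffeoOn g T S := by
  obtain ⟨hb, hf, g, hg, hgT⟩ := h
  have hr : RightInvOn g f T := by
    intro y hy
    obtain ⟨x, hx, rfl⟩ := hb.surjOn hy
    rw [hg hx]
  refine ⟨g, ⟨?_, hr.injOn, ?_⟩, hgT, f, hr, hf⟩
  · intro y hy
    obtain ⟨x, hx, rfl⟩ := hb.surjOn hy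
    rwa [hg hx]
  · exact fun x hx => ⟨f x, hb.mapsTo hx, hg hx⟩

lemma IsDiffeoOn.comp {g : F → G} {f : E → F} {S : Set E} {T : Set F} {R : Set G}
    (hg : IsDiffeoOn g T R) (hf : IsDiffeoOn f S T) : IsDiffeoOn (g ∘ f) S R := by
  obtain ⟨f', hf'⟩ := hf.exists_symm
  obtain ⟨fb, fs, fi, fl, fis⟩ := hf
  obtain ⟨gb, gs, gi, gl, gis⟩ := hg
  refine ⟨gb.comp fb, gs.comp fs fb.mapsTo, fi ∘ gi, ?_, fis.comp gis ?_⟩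
  · intro x hx
    simp [gl (fb.mapsTo hx), fl hx]
  · intro y hy
    obtain ⟨x, hx, rfl⟩ := gb.surjOn hy
    rwa [gl hx]

lemma AreDiffeomorphic.of_isDiffeoOn {f : E → F} {S : Set E} {T : Set F} {R : Set G}
    (h : AreDiffeomorphic S R) (hf : IsDiffeoOn f S T) : AreDiffeomorphic T R := by
  obtain ⟨g, hg⟩ := hf.exists_symm
  obtain ⟨k, hk⟩ := h
  exact ⟨k ∘ g, hk.comp hg⟩

lemma OpenPartialHomeomorph.isDiffeoOn_image {Φ : OpenPartialHomeomorph E F}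
    (h : ContDiffOn ℝ ∞ Φ Φ.source) (h' : ContDiffOn ℝ ∞ Φ.symm Φ.target) {S : Set E} {T : Set F}
    (hS : S ⊆ Φ.source) (hT : Φ '' S = T) : IsDiffeoOn Φ S T := by
  subst hT
  refine ⟨(Φ.injOn.mono hS).bijOn_image, h.smoothOnSubset Φ.open_source hS, Φ.symm,
    Φ.leftInvOn.mono hS, h'.smoothOnSubset Φ.open_target ?_⟩
  rintro _ ⟨x, hx, rfl⟩
  exact Φ.map_source (hS hx)

/-- A smooth map at Lipschitz distance less than one from the identity on an open set is a
diffeomorphism of that set onto an open set. -/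
lemma exists_diffeo_of_lipschitzOnWith_sub_id [CompleteSpace E] [Nontrivial E] {f : E → E}
    {U : Set E} (hU : IsOpen U) (hf : ContDiffOn ℝ ∞ f U) {c : NNReal} (hc : c < 1)
    (hl : LipschitzOnWith c (fun x => f x - x) U) :
    ∃ Φ : OpenPartialHomeomorph E E, Φ.source = U ∧ (∀ x, Φ x = f x) ∧
      ContDiffOn ℝ ∞ Φ Φ.source ∧ ContDiffOn ℝ ∞ Φ.symm Φ.target := by
  have ha : ApproximatesLinearOn f ((ContinuousLinearEquiv.refl ℝ E : E ≃L[ℝ] E) : E →L[ℝ] E)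
      U c := by
    intro x hx y hy
    have e : f x - f y - ((ContinuousLinearEquiv.refl ℝ E : E ≃L[ℝ] E) : E →L[ℝ] E) (x - y)
        = (f x - x) - (f y - y) := by
      change f x - f y - (x - y) = _
      abel
    rw [e]
    exact hl.norm_sub_le hx hy
  -- The side condition is `c < ‖id⁻¹‖⁻¹`, and the norm of the identity is `1` because `E` is
  -- nontrivial.
  let Φ := ha.toOpenPartialHomeomorph f U (Or.inr (by
    have : ‖((ContinuousLinearEquiv.refl ℝ E).symm : E →L[ℝ] E)‖₊ = 1 := by
      simp
    rw [this]; simpa using hc)) hU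
  have hs : Φ.source = U := rfl
  have hΦ : ∀ x, Φ x = f x := fun _ => rfl
  refine ⟨Φ, hs, hΦ, hf, ?_⟩
  intro y hy
  refine ContDiffAt.contDiffWithinAt ?_
  set x := Φ.symm y with hx
  have hxU : x ∈ U := Φ.map_target hy
  have hfx : ContDiffAt ℝ ∞ f x := hf.contDiffAt (hU.mem_nhds hxU)
  have hd : HasFDerivAt f (fderiv ℝ f x) x :=
    (hfx.differentiableAt (by simp)).hasFDerivAt
  have hd' : HasFDerivAt (fun x => f x - x) (fderiv ℝ f x - 1) x := hd.sub (hasFDerivAt_id x)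
  -- The Lipschitz constant bounds the derivative of `f - id`, so `fderiv ℝ f x` is invertible by a
  -- Neumann series.
  have hn := hd'.le_of_lipschitzOn (hU.mem_nhds hxU) hl
  have hn1 : ‖1 - fderiv ℝ f x‖ < 1 := by
    rw [norm_sub_rev]
    exact hn.trans_lt (by exact_mod_cast hc)
  let e : E ≃L[ℝ] E := ContinuousLinearEquiv.ofUnit (Units.oneSub _ hn1)
  have he : (e : E →L[ℝ] E) = fderiv ℝ f x := by
    have : (e : E →L[ℝ] E) = 1 - (1 - fderiv ℝ f x) := rfl
    rw [this, sub_sub_cancel]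
  exact Φ.contDiffAt_symm (f₀' := e) hy (he ▸ hd) hfx

end Diffeo

/-! ### The shift and its effect on the perturbed coordinates. -/

/-- Displacement of a point of `ℝ³` by `ε (δx, δy, 0)`, evaluated at its own polar angle. -/
noncomputable def toroidalShift (ε : ℝ) (X : E3) : E3 :=
  !₂[X 0 - ε * (X 0 / cylRadius X * (1 - (X 0 / cylRadius X) ^ 2 / 3)),
    X 1 - ε * ((X 1 / cylRadius X) ^ 3 / 3), X 2]

lemma toroidalShift_zero (ε : ℝ) (X : E3) : toroidalShift ε X 0 =
    X 0 - ε * (X 0 / cylRadius X * (1 - (X 0 / cylRadius X) ^ 2 / 3)) := rfl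

lemma toroidalShift_one (ε : ℝ) (X : E3) : toroidalShift ε X 1 =
    X 1 - ε * ((X 1 / cylRadius X) ^ 3 / 3) := rfl

lemma toroidalShift_two (ε : ℝ) (X : E3) : toroidalShift ε X 2 = X 2 := rfl

lemma cylRadius_nonneg (X : E3) : 0 ≤ cylRadius X := Real.sqrt_nonneg _

lemma cylRadius_sq (X : E3) : cylRadius X ^ 2 = X 0 ^ 2 + X 1 ^ 2 := Real.sq_sqrt (by positivity)

lemma continuous_cylRadius : Continuous cylRadius := by
  unfold cylRadius
  fun_prop

lemma isOpen_NPrime (ε : ℝ) : IsOpen (NPrime ε) := isOpen_lt continuous_const continuous_cylRadius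

lemma exists_polar_angle (X : E3) : ∃ ζ ∈ Ico 0 (2 * Real.pi),
    X 0 = cylRadius X * Real.cos ζ ∧ X 1 = cylRadius X * Real.sin ζ := by
  have hn : ‖(⟨X 0, X 1⟩ : ℂ)‖ = cylRadius X := by
    rw [Complex.norm_def, Complex.normSq_mk, cylRadius]; ring_nf
  set φ := Complex.arg ⟨X 0, X 1⟩ with hφ
  refine ⟨toIcoMod Real.two_pi_pos 0 φ, by simpa using toIcoMod_mem_Ico Real.two_pi_pos 0 φ, ?_⟩
  rw [toIcoMod, zsmul_eq_mul, Real.cos_sub_int_mul_two_pi, Real.sin_sub_int_mul_two_pi, ← hn,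
    Complex.norm_mul_cos_arg, Complex.norm_mul_sin_arg]
  exact ⟨rfl, rfl⟩

/-- The triangle inequality in the horizontal plane; the cross term is bounded by Cauchy–Schwarz. -/
lemma cylRadius_le_add {X Y : E3} {t : ℝ} (ht : 0 ≤ t)
    (h : (Y 0 - X 0) ^ 2 + (Y 1 - X 1) ^ 2 ≤ t ^ 2) : cylRadius Y ≤ cylRadius X + t := by
  have h0 := cylRadius_nonneg X
  have h1 := cylRadius_sq X
  refine Real.sqrt_le_iff.2 ⟨by positivity, ?_⟩
  have h2 : X 0 * (Y 0 - X 0) + X 1 * (Y 1 - X 1) ≤ cylRadius X * t := by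
    refine le_of_abs_le (abs_le_of_sq_le_sq ?_ (by positivity))
    calc (X 0 * (Y 0 - X 0) + X 1 * (Y 1 - X 1)) ^ 2
        ≤ (X 0 ^ 2 + X 1 ^ 2) * ((Y 0 - X 0) ^ 2 + (Y 1 - X 1) ^ 2) := by
          nlinarith [sq_nonneg (X 0 * (Y 1 - X 1) - X 1 * (Y 0 - X 0))]
      _ ≤ cylRadius X ^ 2 * t ^ 2 := by
          rw [h1]; exact mul_le_mul_of_nonneg_left h (by positivity)
      _ = _ := by ring
  nlinarith

section Shift

variable {ε : ℝ} {X : E3}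

lemma toroidalShift_eq_delta {ζ : ℝ} (hX : 0 < cylRadius X)
    (h0 : X 0 = cylRadius X * Real.cos ζ) (h1 : X 1 = cylRadius X * Real.sin ζ) :
    toroidalShift ε X 0 = X 0 + ε * deltaX ζ ∧ toroidalShift ε X 1 = X 1 + ε * deltaY ζ := by
  have e0 : X 0 / cylRadius X = Real.cos ζ := by rw [div_eq_iff hX.ne', h0]; ring
  have e1 : X 1 / cylRadius X = Real.sin ζ := by rw [div_eq_iff hX.ne', h1]; ring
  rw [toroidalShift_zero, toroidalShift_one, e0, e1, deltaX, deltaY]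
  constructor <;> ring

lemma toroidalShift_displacement (hX : 0 < cylRadius X) :
    (toroidalShift ε X 0 - X 0) ^ 2 + (toroidalShift ε X 1 - X 1) ^ 2 ≤ ε ^ 2 := by
  obtain ⟨ζ, -, h0, h1⟩ := exists_polar_angle X
  obtain ⟨e0, e1⟩ := toroidalShift_eq_delta (ε := ε) hX h0 h1
  rw [e0, e1]
  nlinarith [mul_le_mul_of_nonneg_left (delta_sq_le ζ) (sq_nonneg ε), sq_nonneg ε]

lemma cylRadius_toroidalShift_le (hε : 0 ≤ ε) (hX : 0 < cylRadius X) :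
    cylRadius (toroidalShift ε X) ≤ cylRadius X + ε :=
  cylRadius_le_add hε (toroidalShift_displacement hX)

lemma le_cylRadius_toroidalShift (hε : 0 ≤ ε) (hX : 0 < cylRadius X) :
    cylRadius X ≤ cylRadius (toroidalShift ε X) + ε :=
  cylRadius_le_add hε (by linarith [toroidalShift_displacement (ε := ε) hX])

lemma toroidalAngle_spec (hε : 0 < ε) (hX : X ∈ NPrime ε) :
    IsToroidalAngle ε X (toroidalAngle ε X) := by
  have h := (existsUnique_isToroidalAngle hε hX).exists
  rw [toroidalAngle, dif_pos h]
  exact h.choose_spec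

/-- The polar pair `(r, ζ)` of `X` satisfies the equations defining the toroidal angle of the
shifted point, and `ε < r` gives the condition `ε sin² ζ < r`. Uniqueness does the rest. -/
lemma rhoPert_toroidalShift (hε : 0 < ε) (hX : ε < cylRadius X)
    (hX' : toroidalShift ε X ∈ NPrime ε) : rhoPert ε (toroidalShift ε X) = cylRadius X := by
  have h0 : 0 < cylRadius X := hε.trans hX
  obtain ⟨ζ, hζ, hx, hy⟩ := exists_polar_angle X
  obtain ⟨e0, e1⟩ := toroidalShift_eq_delta (ε := ε) h0 hx hy
  have ht : IsToroidalAngle ε (toroidalShift ε X) ζ := by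
    refine ⟨hζ, cylRadius X, ?_, ?_, ?_⟩
    · nlinarith [Real.sin_sq_le_one ζ]
    · rw [e0, ← hx]
    · rw [e1, ← hy]
  have hu := (existsUnique_isToroidalAngle hε hX').unique (toroidalAngle_spec hε hX') ht
  rw [rhoPert, hu, e0, e1, add_sub_cancel_right, add_sub_cancel_right, cylRadius]

lemma PsiPert_toroidalShift (Ψ₀ r₀ : ℝ) (hε : 0 < ε) (hX : ε < cylRadius X)
    (hX' : toroidalShift ε X ∈ NPrime ε) :
    PsiPert Ψ₀ r₀ ε (toroidalShift ε X) = PsiAxi Ψ₀ r₀ X := by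
  rw [PsiPert, rhoPert_toroidalShift hε hX hX', toroidalShift_two, PsiAxi]

/-- The preimage reads the perturbed coordinates `(ρ, ζ)` of `Y` as ordinary polar coordinates. -/
lemma exists_toroidalShift_eq (hε : 0 < ε) {Y : E3} (hY : Y ∈ NPrime ε) :
    ∃ X : E3, 0 < cylRadius X ∧ toroidalShift ε X = Y := by
  obtain ⟨ζ, ⟨-, ρ, hρ, h0, h1⟩, -⟩ := existsUnique_isToroidalAngle hε hY
  have hρ0 : 0 < ρ := lt_of_le_of_lt (by positivity) hρ
  let X : E3 := !₂[ρ * Real.cos ζ, ρ * Real.sin ζ, Y 2]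
  have hX0 : X 0 = ρ * Real.cos ζ := rfl
  have hX1 : X 1 = ρ * Real.sin ζ := rfl
  have hr : cylRadius X = ρ := by
    rw [cylRadius, hX0, hX1, ← Real.sqrt_sq hρ0.le]
    congr 1
    rw [Real.sqrt_sq hρ0.le]
    linear_combination ρ ^ 2 * Real.sin_sq_add_cos_sq ζ
  obtain ⟨e0, e1⟩ := toroidalShift_eq_delta (ε := ε) (X := X) (ζ := ζ) (hr ▸ hρ0) (by rw [hr, hX0]) (by rw [hr, hX1])
  refine ⟨X, hr ▸ hρ0, ?_⟩
  ext i
  fin_cases i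
  · exact e0.trans h0.symm
  · exact e1.trans h1.symm
  · rfl

end Shift

/-! ### Smoothness and Lipschitz estimates for the shift. -/

lemma contDiffAt_cylRadius {X : E3} (hX : 0 < cylRadius X) : ContDiffAt ℝ ∞ cylRadius X := by
  unfold cylRadius
  refine ContDiffAt.sqrt (by fun_prop) ?_
  rw [← cylRadius_sq]
  positivity

lemma contDiffAt_toroidalShift (ε : ℝ) {X : E3} (hX : 0 < cylRadius X) :
    ContDiffAt ℝ ∞ (toroidalShift ε) X := by
  have hr := contDiffAt_cylRadius hX
  have h0 : ContDiffAt ℝ ∞ (fun X : E3 => X 0 / cylRadius X) X :=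
    ContDiffAt.div (by fun_prop) hr hX.ne'
  have h1 : ContDiffAt ℝ ∞ (fun X : E3 => X 1 / cylRadius X) X :=
    ContDiffAt.div (by fun_prop) hr hX.ne'
  rw [contDiffAt_euclidean]
  intro i
  fin_cases i
  · change ContDiffAt ℝ ∞ (fun X : E3 =>
      X 0 - ε * (X 0 / cylRadius X * (1 - (X 0 / cylRadius X) ^ 2 / 3))) X
    fun_prop
  · change ContDiffAt ℝ ∞ (fun X : E3 => X 1 - ε * ((X 1 / cylRadius X) ^ 3 / 3)) X
    fun_prop
  · change ContDiffAt ℝ ∞ (fun X : E3 => X 2) X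
    fun_prop

/-- Radial projection to the unit circle is `1/m`-Lipschitz outside radius `m`. By the law of
cosines, `r s` times the squared chord is the squared distance minus `(r - s)²`. -/
lemma chord_sq_le {a b c d r s m : ℝ} (hm : 0 < m) (hr : m ≤ r) (hs : m ≤ s)
    (hab : a ^ 2 + b ^ 2 = r ^ 2) (hcd : c ^ 2 + d ^ 2 = s ^ 2) :
    m ^ 2 * ((a / r - c / s) ^ 2 + (b / r - d / s) ^ 2) ≤ (a - c) ^ 2 + (b - d) ^ 2 := by
  have hr0 : 0 < r := hm.trans_le hr
  have hs0 : 0 < s := hm.trans_le hs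
  have e : r * s * ((a / r - c / s) ^ 2 + (b / r - d / s) ^ 2)
      = (a - c) ^ 2 + (b - d) ^ 2 - (r - s) ^ 2 := by
    field_simp
    linear_combination (s ^ 2 - r * s) * hab + (r ^ 2 - r * s) * hcd
  calc _ ≤ r * s * ((a / r - c / s) ^ 2 + (b / r - d / s) ^ 2) := by
        refine mul_le_mul_of_nonneg_right ?_ (by positivity)
        rw [sq]; exact mul_le_mul hr hs hm.le hr0.le
    _ ≤ _ := by rw [e]; linarith [sq_nonneg (r - s)]

/-- Each component difference is `a - c` or `b - d` times a factor in `[0, 1]`, because all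
coordinates lie in `[-1, 1]`. -/
lemma cubic_difference_sq_le {a b c d : ℝ} (h1 : a ^ 2 + b ^ 2 = 1) (h2 : c ^ 2 + d ^ 2 = 1) :
    (a * (1 - a ^ 2 / 3) - c * (1 - c ^ 2 / 3)) ^ 2 + (b ^ 3 / 3 - d ^ 3 / 3) ^ 2
      ≤ (a - c) ^ 2 + (b - d) ^ 2 := by
  have key : ∀ t u : ℝ, 0 ≤ t → t ≤ 1 → (u * t) ^ 2 ≤ u ^ 2 := by
    intro t u h0 h1
    rw [mul_pow]
    exact mul_le_of_le_one_right (sq_nonneg u) (pow_le_one₀ h0 h1)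
  have e1 := key (1 - (a ^ 2 + a * c + c ^ 2) / 3) (a - c)
    (by nlinarith [sq_nonneg (a - c), sq_nonneg b, sq_nonneg d]) (by nlinarith [sq_nonneg (a + c)])
  have e2 := key ((b ^ 2 + b * d + d ^ 2) / 3) (b - d)
    (by nlinarith [sq_nonneg (b + d)]) (by nlinarith [sq_nonneg (b - d), sq_nonneg a, sq_nonneg c])
  have f1 : a * (1 - a ^ 2 / 3) - c * (1 - c ^ 2 / 3)
      = (a - c) * (1 - (a ^ 2 + a * c + c ^ 2) / 3) := by ring
  have f2 : b ^ 3 / 3 - d ^ 3 / 3 = (b - d) * ((b ^ 2 + b * d + d ^ 2) / 3) := by ring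
  rw [f1, f2]
  exact add_le_add e1 e2

lemma lipschitzOnWith_toroidalShift_sub_id {ε : ℝ} (hε : 0 < ε) :
    LipschitzOnWith (1 / 2) (fun X => toroidalShift ε X - X) {X : E3 | 2 * ε ≤ cylRadius X} := by
  refine LipschitzOnWith.of_dist_le_mul fun X hX Y hY => ?_
  have hX0 : 0 < cylRadius X := lt_of_lt_of_le (by positivity) hX
  have hY0 : 0 < cylRadius Y := lt_of_lt_of_le (by positivity) hY
  have unit : ∀ Z : E3, 0 < cylRadius Z →
      (Z 0 / cylRadius Z) ^ 2 + (Z 1 / cylRadius Z) ^ 2 = 1 := by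
    intro Z hZ
    rw [div_pow, div_pow, ← add_div, ← cylRadius_sq, div_self (by positivity)]
  have h1 := cubic_difference_sq_le (unit X hX0) (unit Y hY0)
  have h2 := chord_sq_le (by positivity : 0 < 2 * ε) hX hY (cylRadius_sq X).symm
    (cylRadius_sq Y).symm
  have e : ((1 / 2 : NNReal) : ℝ) = 1 / 2 := by norm_num
  rw [dist_eq_norm, dist_eq_norm, e]
  refine le_of_abs_le (abs_le_of_sq_le_sq ?_ (by positivity))
  rw [mul_pow, EuclideanSpace.norm_sq_eq, EuclideanSpace.norm_sq_eq, Fin.sum_univ_three,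
    Fin.sum_univ_three]
  simp only [PiLp.sub_apply, Real.norm_eq_abs, sq_abs, toroidalShift_zero, toroidalShift_one,
    toroidalShift_two]
  nlinarith [mul_le_mul_of_nonneg_left h1 (sq_nonneg ε), sq_nonneg (X 2 - Y 2)]

/-! ### Level sets of the axisymmetric function as tori. -/

lemma exists_cylRadius_eq {r z : ℝ} (hr : 0 ≤ r) :
    ∃ X : E3, cylRadius X = r ∧ X 2 = z := by
  refine ⟨!₂[r, 0, z], ?_, rfl⟩
  change Real.sqrt (r ^ 2 + 0 ^ 2) = r
  rw [zero_pow two_ne_zero, add_zero, Real.sqrt_sq hr]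

lemma mem_levelAxi_iff {Ψ₀ r₀ c : ℝ} {X : E3} :
    X ∈ levelAxi Ψ₀ r₀ c ↔ (cylRadius X - r₀) ^ 2 + X 2 ^ 2 = Ψ₀ - c := by
  simp only [levelAxi, PsiAxi, mem_ofPred_eq]
  constructor <;> intro h <;> linarith

/-- A level set of `Ψ_A` that avoids the axis is a torus. -/
lemma areDiffeomorphic_levelAxi_torus2 {Ψ₀ r₀ c : ℝ} (hr₀ : 0 < r₀) (hc : c < Ψ₀)
    (h : ∀ X ∈ levelAxi Ψ₀ r₀ c, 0 < cylRadius X) :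
    AreDiffeomorphic (levelAxi Ψ₀ r₀ c) torus2 := by
  set s := Real.sqrt (Ψ₀ - c) with hs
  have hs0 : 0 < s := Real.sqrt_pos.2 (by linarith)
  have hs2 : s ^ 2 = Ψ₀ - c := Real.sq_sqrt (by linarith)
  have hsr : s < r₀ := by
    -- If `r₀ ≤ s`, the meridian circle of radius `s` about `(r₀, 0)` meets the axis at height `√(s²
    -- - r₀²)`.
    by_contra! hle
    obtain ⟨X, hX, hX2⟩ := exists_cylRadius_eq (r := 0) (z := Real.sqrt (s ^ 2 - r₀ ^ 2)) le_rfl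
    refine (h X ?_).ne' hX
    rw [mem_levelAxi_iff, hX, hX2, Real.sq_sqrt (by nlinarith), hs2]
    ring
  let f : E3 → EuclideanSpace ℝ (Fin 2) × EuclideanSpace ℝ (Fin 2) := fun X =>
    (!₂[X 0 / cylRadius X, X 1 / cylRadius X], !₂[(cylRadius X - r₀) / s, X 2 / s])
  let g : EuclideanSpace ℝ (Fin 2) × EuclideanSpace ℝ (Fin 2) → E3 := fun p =>
    !₂[(r₀ + s * p.2 0) * p.1 0, (r₀ + s * p.2 0) * p.1 1, s * p.2 1]
  have hmem : ∀ p, p ∈ torus2 ↔ p.1 0 ^ 2 + p.1 1 ^ 2 = 1 ∧ p.2 0 ^ 2 + p.2 1 ^ 2 = 1 := by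
    intro p
    have : ∀ v : EuclideanSpace ℝ (Fin 2), v ∈ Metric.sphere 0 1 ↔ v 0 ^ 2 + v 1 ^ 2 = 1 := by
      intro v
      rw [mem_sphere_zero_iff_norm, EuclideanSpace.norm_eq, Real.sqrt_eq_one, Fin.sum_univ_two]
      simp
    rw [torus2, mem_prod, this, this]
  have hfm : MapsTo f (levelAxi Ψ₀ r₀ c) torus2 := by
    intro X hX
    have hr := h X hX
    rw [mem_levelAxi_iff, ← hs2] at hX
    refine (hmem _).2 ⟨?_, ?_⟩
    · change (X 0 / cylRadius X) ^ 2 + (X 1 / cylRadius X) ^ 2 = 1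
      rw [div_pow, div_pow, ← add_div, ← cylRadius_sq, div_self (by positivity)]
    · change ((cylRadius X - r₀) / s) ^ 2 + (X 2 / s) ^ 2 = 1
      rw [div_pow, div_pow, ← add_div, hX, div_self (by positivity)]
  have hgr : ∀ p ∈ torus2, cylRadius (g p) = r₀ + s * p.2 0 ∧ 0 < r₀ + s * p.2 0 := by
    intro p hp
    obtain ⟨h1, h2⟩ := (hmem p).1 hp
    have hb : -1 ≤ p.2 0 := by nlinarith [sq_nonneg (p.2 1)]
    have hpos : 0 < r₀ + s * p.2 0 := by nlinarith
    refine ⟨?_, hpos⟩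
    change Real.sqrt (((r₀ + s * p.2 0) * p.1 0) ^ 2 + ((r₀ + s * p.2 0) * p.1 1) ^ 2) = _
    rw [mul_pow, mul_pow, ← mul_add, h1, mul_one, Real.sqrt_sq hpos.le]
  have hgm : MapsTo g torus2 (levelAxi Ψ₀ r₀ c) := by
    intro p hp
    rw [mem_levelAxi_iff, (hgr p hp).1, ← hs2]
    change (r₀ + s * p.2 0 - r₀) ^ 2 + (s * p.2 1) ^ 2 = s ^ 2
    linear_combination s ^ 2 * ((hmem p).1 hp).2
  have hgf : LeftInvOn g f (levelAxi Ψ₀ r₀ c) := by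
    intro X hX
    have hr := h X hX
    ext i
    fin_cases i
    · change (r₀ + s * ((cylRadius X - r₀) / s)) * (X 0 / cylRadius X) = X 0
      field_simp
      ring
    · change (r₀ + s * ((cylRadius X - r₀) / s)) * (X 1 / cylRadius X) = X 1
      field_simp
      ring
    · change s * (X 2 / s) = X 2
      field_simp
  have hfg : RightInvOn g f torus2 := by
    intro p hp
    obtain ⟨e, hpos⟩ := hgr p hp
    refine Prod.ext ?_ ?_ <;> ext i <;> fin_cases i
    · change ((r₀ + s * p.2 0) * p.1 0) / cylRadius (g p) = p.1 0
      rw [e]; field_simp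
    · change ((r₀ + s * p.2 0) * p.1 1) / cylRadius (g p) = p.1 1
      rw [e]; field_simp
    · change (cylRadius (g p) - r₀) / s = p.2 0
      rw [e]; field_simp; ring
    · change s * p.2 1 / s = p.2 1
      field_simp
  refine ⟨f, (show InvOn g f _ _ from ⟨hgf, hfg⟩).bijOn hfm hgm, ?_, g, hgf, ?_⟩
  · refine ContDiffOn.smoothOnSubset (U := {X | 0 < cylRadius X}) ?_
      (isOpen_lt continuous_const continuous_cylRadius) h
    intro X hX
    have hr := contDiffAt_cylRadius hX
    have hX' : cylRadius X ≠ 0 := ne_of_gt hX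
    refine ContDiffAt.contDiffWithinAt (ContDiffAt.prodMk ?_ ?_) <;>
      refine contDiffAt_euclidean.2 fun i => ?_ <;> fin_cases i
    · change ContDiffAt ℝ ∞ (fun X : E3 => X 0 / cylRadius X) X
      exact ContDiffAt.div (by fun_prop) hr hX'
    · change ContDiffAt ℝ ∞ (fun X : E3 => X 1 / cylRadius X) X
      exact ContDiffAt.div (by fun_prop) hr hX'
    · change ContDiffAt ℝ ∞ (fun X : E3 => (cylRadius X - r₀) / s) X
      fun_prop
    · change ContDiffAt ℝ ∞ (fun X : E3 => X 2 / s) X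
      fun_prop
  · refine ContDiffOn.smoothOnSubset (U := univ) ?_ isOpen_univ (subset_univ _)
    refine ContDiff.contDiffOn (contDiff_euclidean.2 fun i => ?_)
    fin_cases i
    · change ContDiff ℝ ∞ (fun p : EuclideanSpace ℝ (Fin 2) × EuclideanSpace ℝ (Fin 2) =>
        (r₀ + s * p.2 0) * p.1 0)
      fun_prop
    · change ContDiff ℝ ∞ (fun p : EuclideanSpace ℝ (Fin 2) × EuclideanSpace ℝ (Fin 2) =>
        (r₀ + s * p.2 0) * p.1 1)
      fun_prop
    · change ContDiff ℝ ∞ (fun p : EuclideanSpace ℝ (Fin 2) × EuclideanSpace ℝ (Fin 2) =>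
        s * p.2 1)
      fun_prop

/-! ### The diffeomorphism and complete level sets. -/

lemma mul_lt_of_mem_NPrime {ε : ℝ} (hε : 0 < ε) {X : E3} (hX : X ∈ NPrime ε) :
    12 / 5 * ε < cylRadius X := by
  have h2 : (1.4 : ℝ) ≤ Real.sqrt 2 := Real.le_sqrt_of_sq_le (by norm_num)
  have : ε * (1 + Real.sqrt 2) < cylRadius X := hX
  nlinarith

lemma mem_NPrime_of_lt {ε : ℝ} (hε : 0 < ε) {X : E3} (hX : 5 / 2 * ε < cylRadius X) :
    X ∈ NPrime ε := by
  have h2 : Real.sqrt 2 ≤ 3 / 2 := Real.sqrt_le_iff.2 ⟨by norm_num, by norm_num⟩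
  change ε * (1 + Real.sqrt 2) < cylRadius X
  nlinarith

/-- Intersecting with the preimage of `NPrime ε` forces the target into `NPrime ε` too. -/
lemma exists_toroidalShift_diffeo {ε : ℝ} (hε : 0 < ε) :
    ∃ Φ : OpenPartialHomeomorph E3 E3, Φ.source = NPrime ε ∩ toroidalShift ε ⁻¹' NPrime ε ∧
      (∀ X, Φ X = toroidalShift ε X) ∧
      ContDiffOn ℝ ∞ Φ Φ.source ∧ ContDiffOn ℝ ∞ Φ.symm Φ.target := by
  have hpos : ∀ X ∈ NPrime ε, 2 * ε < cylRadius X := fun X hX => by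
    linarith [mul_lt_of_mem_NPrime hε hX]
  have hsm : ContDiffOn ℝ ∞ (toroidalShift ε) (NPrime ε) := fun X hX =>
    (contDiffAt_toroidalShift ε (by linarith [hpos X hX])).contDiffWithinAt
  exact exists_diffeo_of_lipschitzOnWith_sub_id
    (hsm.continuousOn.isOpen_inter_preimage (isOpen_NPrime ε) (isOpen_NPrime ε))
    (hsm.mono inter_subset_left) (by
      rw [← NNReal.coe_lt_coe]; norm_num)
    ((lipschitzOnWith_toroidalShift_sub_id hε).mono fun X hX => (hpos X hX.1).le)

/-- If the complete level set of `Ψ` lies in `N'_{ε₀}`, then that of `Ψ_A` stays away from the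
axis. -/
lemma lt_cylRadius_of_levelPert_subset {Ψ₀ r₀ ε ε₀ c : ℝ} (hε : 0 < ε) (h₀ : 4 * ε < ε₀)
    (hr : 4 * ε < r₀) (hsub : levelPert Ψ₀ r₀ ε c ⊆ NPrime ε₀) {X : E3}
    (hX : X ∈ levelAxi Ψ₀ r₀ c) : 3 / 2 * ε₀ ≤ cylRadius X := by
  -- A gap: the shift carries such a `Y` into the perturbed level set, hence into `NPrime ε₀`, so no
  -- point of the level set has radius in `(4ε, 2ε₀]`.
  have push : ∀ Y ∈ levelAxi Ψ₀ r₀ c, 4 * ε < cylRadius Y → 2 * ε₀ < cylRadius Y := by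
    intro Y hY hlt
    have hN : toroidalShift ε Y ∈ NPrime ε := mem_NPrime_of_lt hε (by
      linarith [le_cylRadius_toroidalShift hε.le (X := Y) (by linarith)])
    have hL : toroidalShift ε Y ∈ levelPert Ψ₀ r₀ ε c :=
      ⟨hN, (PsiPert_toroidalShift Ψ₀ r₀ hε (by linarith) hN).trans hY⟩
    linarith [mul_lt_of_mem_NPrime (by linarith) (hsub hL),
      cylRadius_toroidalShift_le hε.le (X := Y) (by linarith)]
  have hX' := mem_levelAxi_iff.1 hX
  set s := Real.sqrt (Ψ₀ - c) with hs
  have hs2 : s ^ 2 = Ψ₀ - c := Real.sq_sqrt (hX' ▸ by positivity)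
  have hs0 : 0 ≤ s := Real.sqrt_nonneg _
  -- The outermost point of the meridian circle lies beyond the gap; `4 * ε < r₀` is needed to apply
  -- `push` to it.
  obtain ⟨Y, hY, hY2⟩ := exists_cylRadius_eq (r := r₀ + s) (z := 0) (by linarith)
  have hout := push Y (by rw [mem_levelAxi_iff, hY, hY2, ← hs2]; ring) (by linarith)
  by_contra! hlt
  have hb : r₀ - cylRadius X ≤ s := by
    refine le_of_abs_le (abs_le_of_sq_le_sq ?_ hs0)
    nlinarith [sq_nonneg (X 2)]
  -- A circle with points on both sides of radius `3/2 ε₀` has a point at that radius, which lies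
  -- inside the gap.
  obtain ⟨Z, hZ, hZ2⟩ := exists_cylRadius_eq (r := 3 / 2 * ε₀)
    (z := Real.sqrt (s ^ 2 - (3 / 2 * ε₀ - r₀) ^ 2)) (by linarith)
  have hZm : Z ∈ levelAxi Ψ₀ r₀ c := by
    rw [mem_levelAxi_iff, hZ, hZ2, Real.sq_sqrt, ← hs2]
    · ring
    · have := sq_le_sq' (a := 3 / 2 * ε₀ - r₀) (b := s) (by linarith) (by linarith)
      linarith
  linarith [push Z hZm (by linarith)]

theorem proposition3 (Ψ₀ r₀ ε₀ : ℝ) (hΨ₀ : 0 < Ψ₀) (hr₀ : 0 < r₀) (hε₀ : 0 < ε₀)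
    (Ω : Set E3) (hbdd : Bornology.IsBounded Ω) (hΩ : Ω ⊆ NPrime ε₀) :
    ∃ ε₁ : ℝ, 0 < ε₁ ∧ ∀ ε : ℝ, 0 < ε → ε < ε₁ →
      ∃ Φ : OpenPartialHomeomorph E3 E3,
        -- `Φ` is a smooth diffeomorphism between open neighbourhoods in `N'` of the closure of `Ω`
        ContDiffOn ℝ ∞ Φ Φ.source ∧ ContDiffOn ℝ ∞ Φ.symm Φ.target ∧
        closure Ω ⊆ Φ.source ∧ closure Ω ⊆ Φ.target ∧
        Φ.source ⊆ NPrime ε ∧ Φ.target ⊆ NPrime ε ∧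
        -- that pulls `Ψ` back to `Ψ_A`
        (∀ X ∈ Φ.source, PsiPert Ψ₀ r₀ ε (Φ X) = PsiAxi Ψ₀ r₀ X) ∧
        -- hence carries the level sets in `Ω` diffeomorphically to level sets, both ways
        (∀ c : ℝ,
          IsDiffeoOn Φ (levelAxi Ψ₀ r₀ c ∩ Ω) (levelPert Ψ₀ r₀ ε c ∩ Φ '' Ω) ∧
          IsDiffeoOn Φ.symm (levelPert Ψ₀ r₀ ε c ∩ Ω) (levelAxi Ψ₀ r₀ c ∩ Φ.symm '' Ω)) ∧
        -- and complete level sets lying in `Ω` to complete level sets, which are tori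
        (∀ c : ℝ, levelAxi Ψ₀ r₀ c ⊆ Ω ∨ levelPert Ψ₀ r₀ ε c ⊆ Ω →
          IsDiffeoOn Φ (levelAxi Ψ₀ r₀ c) (levelPert Ψ₀ r₀ ε c) ∧
          (c < Ψ₀ → AreDiffeomorphic (levelAxi Ψ₀ r₀ c) torus2 ∧
            AreDiffeomorphic (levelPert Ψ₀ r₀ ε c) torus2)) := by
  -- `ε₀ / 4` leaves room for displacements of size `ε` around the closure of `Ω`; `r₀ / 4` serves
  -- only `lt_cylRadius_of_levelPert_subset`.
  refine ⟨min (ε₀ / 4) (r₀ / 4), by positivity, fun ε hε hlt => ?_⟩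
  have h₀ : 4 * ε < ε₀ := by linarith [hlt.trans_le (min_le_left _ _)]
  have hr : 4 * ε < r₀ := by linarith [hlt.trans_le (min_le_right _ _)]
  obtain ⟨Φ, hs, hΦ, hsm, hsm'⟩ := exists_toroidalShift_diffeo hε
  have hsrc : ∀ X, 4 * ε < cylRadius X → X ∈ Φ.source := by
    intro X hX
    rw [hs]
    exact ⟨mem_NPrime_of_lt hε (by linarith), mem_NPrime_of_lt hε (by
      linarith [le_cylRadius_toroidalShift hε.le (X := X) (by linarith)])⟩
  have hcl : ∀ X ∈ closure Ω, 2 * ε₀ ≤ cylRadius X := by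
    have hc : IsClosed {X : E3 | 2 * ε₀ ≤ cylRadius X} :=
      isClosed_le continuous_const continuous_cylRadius
    exact closure_minimal (fun X hX => by
      have := mul_lt_of_mem_NPrime hε₀ (hΩ hX)
      change 2 * ε₀ ≤ cylRadius X
      linarith) hc
  have hΩs : closure Ω ⊆ Φ.source := fun X hX => hsrc X (by linarith [hcl X hX])
  have hΩt : closure Ω ⊆ Φ.target := by
    intro Y hY
    have hYr := hcl Y hY
    obtain ⟨X, hX, rfl⟩ := exists_toroidalShift_eq hε
      (mem_NPrime_of_lt hε (by linarith) : Y ∈ NPrime ε)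
    rw [← hΦ X]
    exact Φ.map_source (hsrc X (by linarith [cylRadius_toroidalShift_le hε.le hX]))
  have hsN : Φ.source ⊆ NPrime ε := hs ▸ inter_subset_left
  have htN : Φ.target ⊆ NPrime ε := by
    intro Y hY
    have h := Φ.map_target hY
    rw [hs] at h
    have h2 := h.2
    rwa [mem_preimage, ← hΦ, Φ.right_inv hY] at h2
  have hΨ : ∀ X ∈ Φ.source, PsiPert Ψ₀ r₀ ε (Φ X) = PsiAxi Ψ₀ r₀ X := by
    intro X hX
    have hXN := mul_lt_of_mem_NPrime hε (hsN hX)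
    have := htN (Φ.map_source hX)
    rw [hΦ] at this ⊢
    exact PsiPert_toroidalShift Ψ₀ r₀ hε (by linarith) this
  refine ⟨Φ, hsm, hsm', hΩs, hΩt, hsN, htN, hΨ, fun c => ⟨?_, ?_⟩, fun c hc => ?_⟩
  · refine Φ.isDiffeoOn_image hsm hsm'
      (fun X hX => hΩs (subset_closure hX.2)) (Subset.antisymm ?_ ?_)
    · rintro _ ⟨X, ⟨hXl, hXΩ⟩, rfl⟩
      have hXs := hΩs (subset_closure hXΩ)
      exact ⟨⟨htN (Φ.map_source hXs), (hΨ X hXs).trans hXl⟩, X, hXΩ, rfl⟩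
    · rintro _ ⟨⟨-, hl⟩, X, hXΩ, rfl⟩
      exact ⟨X, ⟨(hΨ X (hΩs (subset_closure hXΩ))).symm.trans hl, hXΩ⟩, rfl⟩
  · refine Φ.symm.isDiffeoOn_image hsm' hsm
      (fun Y hY => hΩt (subset_closure hY.2)) (Subset.antisymm ?_ ?_)
    · rintro _ ⟨Y, ⟨⟨-, hYl⟩, hYΩ⟩, rfl⟩
      have hYt := hΩt (subset_closure hYΩ)
      have h := hΨ _ (Φ.map_target hYt)
      rw [Φ.right_inv hYt] at h
      exact ⟨h.symm.trans hYl, Y, hYΩ, rfl⟩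
    · rintro _ ⟨hl, Y, hYΩ, rfl⟩
      have hYt := hΩt (subset_closure hYΩ)
      have h := hΨ _ (Φ.map_target hYt)
      rw [Φ.right_inv hYt] at h
      exact ⟨Y, ⟨⟨htN hYt, h.trans hl⟩, hYΩ⟩, rfl⟩
  · have hsub : levelAxi Ψ₀ r₀ c ⊆ Φ.source := by
      rcases hc with hc | hc
      · exact fun X hX => hΩs (subset_closure (hc hX))
      · exact fun X hX => hsrc X (by
          linarith [lt_cylRadius_of_levelPert_subset hε h₀ hr (hc.trans hΩ) hX])
    have hd : IsDiffeoOn Φ (levelAxi Ψ₀ r₀ c) (levelPert Ψ₀ r₀ ε c) := by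
      refine Φ.isDiffeoOn_image hsm hsm' hsub (Subset.antisymm ?_ ?_)
      · rintro _ ⟨X, hX, rfl⟩
        exact ⟨htN (Φ.map_source (hsub hX)), (hΨ X (hsub hX)).trans hX⟩
      · rintro Y ⟨hYN, hYl⟩
        obtain ⟨X, hX, rfl⟩ := exists_toroidalShift_eq hε hYN
        -- Only `ε < r` is needed for the pullback identity, so `X` is placed on the level set
        -- before it is known to lie in the source.
        have hXε : ε < cylRadius X := by
          linarith [cylRadius_toroidalShift_le hε.le hX, mul_lt_of_mem_NPrime hε hYN]
        exact ⟨X, (PsiPert_toroidalShift Ψ₀ r₀ hε hXε hYN).symm.trans hYl, hΦ X⟩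
    refine ⟨hd, fun hcΨ => ?_⟩
    have ht := areDiffeomorphic_levelAxi_torus2 hr₀ hcΨ fun X hX => by
      linarith [mul_lt_of_mem_NPrime hε (hsN (hsub hX))]
    exact ⟨ht, ht.of_isDiffeoOn hd⟩
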